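/- All graphs are finite and simple. For a natural number $h$, a graph $G$ is in the class $[h,2,1]$ if there are a finite tree $T$ of maximum degree at most $h$ and a family $(P_v)_{v\in V(G)}$ of (nonempty, possibly one-vertex) subpaths of $T$ such that any two distinct vertices $u,v$ of $G$ are adjacent if and only if $P_u$ and $P_v$ have at least one vertex in common. $G$ is a VPT graph if the same holds without any restriction on the maximum degree of $T$. A clique of $G$ is an inclusion-maximal set of pairwise adjacent vertices. For a clique $C$ of $G$, the branch graph $B(G/C)$ has as vertices the vertices of $V(G)\setminus C$ that are adjacent to some vertex of $C$; two of them, $v$ and $w$, are adjacent in $B(G/C)$ if and only if (1) $vw\notin E(G)$; (2) some vertex of $C$ is adjacent in $G$ to both $v$ and $w$; and (3) there are $v',w'\in C$ such that $v'$ is adjacent to $v$ and not to $w$, and $w'$ is adjacent to $w$ and not to $v$. Theorem. Let $G$ be a VPT graph and let $h\ge 3$ be an integer. Then $G$ belongs to $[h,2,1]$ if and only if $B(G/C)$ is $h$-colorable for every clique $C$ of $G$. Moreover, if $G$ belongs to $[2,2,1]$, then $B(G/C)$ is $2$-colorable for every clique $C$ of $G$. -/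

import Mathlib

/-- `HasRepresentation h s t G`: the graph `G` has an `(h,s,t)`-representation, i.e. `G` belongs to
the class `[h,s,t]`. The value `⊤` for `h` or `s` means that the degree is not restricted.

There are a finite tree `T` of maximum degree at most `h` and a family of subtrees of `T` indexed by
the vertices of `G`, each of maximum degree at most `s`, such that two distinct vertices of `G` are
adjacent if and only if the corresponding subtrees have at least `t` vertices in common.
A subtree of a tree is given by its (nonempty) vertex set `P v`; its edges are all edges
of `T` between these vertices. (As `T` is finite, it is no restriction that `W` lives in `Type`.) -/
def HasRepresentation (h s : ℕ∞) (t : ℕ) {V : Type*} (G : SimpleGraph V) : Prop :=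
  ∃ (W : Type) (_ : Finite W) (T : SimpleGraph W) (P : V → Set W),
    T.IsTree ∧
    (∀ x : W, (T.neighborSet x).encard ≤ h) ∧
    (∀ v : V, (T.induce (P v)).IsTree ∧
      ∀ x : P v, ((T.induce (P v)).neighborSet x).encard ≤ s) ∧
    (∀ u v : V, u ≠ v → (G.Adj u v ↔ (t : ℕ∞) ≤ (P u ∩ P v).encard))

/-- `VPT` graphs: vertex intersection graphs of paths in a tree, the class `[∞,2,1]`.
(A subtree of maximum degree at most two is a path, possibly with a single vertex.) -/
def IsVPT {V : Type*} (G : SimpleGraph V) : Prop :=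
  HasRepresentation ⊤ 2 1 G

/-- A clique in the sense of an inclusion-maximal complete set of vertices. -/
def IsMaxClique {V : Type*} (G : SimpleGraph V) (C : Set V) : Prop :=
  Maximal (fun S : Set V => G.IsClique S) C

/-- The vertex set of the branch graph of `G` for `C`: the vertices outside `C` that are adjacent
to some vertex of `C`. -/
def branchVerts {V : Type*} (G : SimpleGraph V) (C : Set V) : Set V :=
  {v | v ∉ C ∧ ∃ c ∈ C, G.Adj c v}

/-- The branch graph `B(G/C)`. -/
def branchGraph {V : Type*} (G : SimpleGraph V) (C : Set V) :
    SimpleGraph (branchVerts G C) where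
  Adj v w :=
    ¬ G.Adj v w ∧
    (∃ c ∈ C, G.Adj c v ∧ G.Adj c w) ∧
    (∃ v' ∈ C, ∃ w' ∈ C, (G.Adj v' v ∧ ¬ G.Adj v' w) ∧ (G.Adj w' w ∧ ¬ G.Adj w' v))
  symm := ⟨by
    rintro v w ⟨h1, ⟨c, hc, hv, hw⟩, v', hv', w', hw', h2, h3⟩
    exact ⟨fun h => h1 h.symm, ⟨c, hc, hw, hv⟩, w', hw', v', hv', h3, h2⟩⟩
  loopless := ⟨by
    rintro v ⟨-, -, v', -, w', -, h2, -⟩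
    exact h2.2 h2.1⟩

/-! Everything is local at a vertex `q` of the host tree. By the Helly property
(`exists_common_vertex`) a maximal clique `C` consists of all paths through some `q`, and every
other path lies behind a single edge at `q`. Colouring each branch vertex by that edge is proper: a
path of `C` meeting both of two paths behind the same edge would have to follow them through ever
smaller sides, never separating them (`false_of_same_side`). So degree at most `h` gives `h`
colours.

Conversely, take any model and contract edges `q e` for which every path through `e` contains `q`.
Afterwards the paths through each vertex `q` form a maximal clique (`isMaxClique_mem`), and each
neighbour `i` of `q` lies on a path avoiding `q`, which represents `i` in the branch graph. An
`h`-colouring of that graph yields colours on the neighbours of `q` such that no path runs through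
`q` between two of the same colour (`exists_nbr_coloring`). If `q` has more than `h` neighbours, two
of them, `i` and `j`, share a colour; they are detached from `q` and hung on a new vertex adjacent
to `q`. No path used both, so paths stay paths, the colourings carry over, and the total excess of
the degrees over `h` drops. The new vertex has degree three, whence `h ≥ 3`. -/

namespace SimpleGraph

/-! ### Sides of edges in a tree -/

variable {W : Type*} {T : SimpleGraph W}

/-- The vertices on the `e`-side of the edge `q e`: those that `e` still reaches once this edge is
deleted. -/
def side (T : SimpleGraph W) (q e : W) : Set W :=
  {w | (T.deleteEdges {s(q, e)}).Reachable e w}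

theorem Reachable.mem_of_closed {a b : W} (h : T.Reachable a b) {S : Set W}
    (hS : ∀ x ∈ S, ∀ y, T.Adj x y → y ∈ S) (ha : a ∈ S) : b ∈ S := by
  rw [reachable_iff_reflTransGen] at h
  induction h with
  | refl => exact ha
  | tail _ hbc ih => exact hS _ ih _ hbc

theorem mem_side_self (T : SimpleGraph W) (q e : W) : e ∈ T.side q e :=
  Reachable.refl _

theorem IsAcyclic.notMem_side (hT : T.IsAcyclic) {q e : W} (h : T.Adj q e) : q ∉ T.side q e := by
  intro hq
  exact isAcyclic_iff_forall_adj_isBridge.1 hT h (Reachable.symm hq)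

/-- The only edge leaving the side `side q e` is `e q`. -/
theorem IsAcyclic.eq_of_leaves_side (hT : T.IsAcyclic) {q e w w' : W} (h : T.Adj q e)
    (hw : w ∈ T.side q e) (hw' : w' ∉ T.side q e) (hadj : T.Adj w w') : w = e ∧ w' = q := by
  by_cases hs : s(w, w') = s(q, e)
  · rcases Sym2.eq_iff.1 hs with ⟨rfl, rfl⟩ | ⟨rfl, rfl⟩
    · exact absurd hw (hT.notMem_side h)
    · exact ⟨rfl, rfl⟩
  · refine absurd (Reachable.trans hw (Adj.reachable ?_)) hw'
    rw [deleteEdges_adj]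
    exact ⟨hadj, by simpa using hs⟩

theorem side_induction {q e : W} {S : Set W} (he : e ∈ S)
    (hS : ∀ x ∈ T.side q e, x ∈ S → ∀ y, T.Adj x y → y ∈ T.side q e → y ∈ S) :
    T.side q e ⊆ S := by
  intro w hw
  have := Reachable.mem_of_closed (S := S ∩ T.side q e) hw ?_ ⟨he, mem_side_self _ _ _⟩
  · exact this.1
  · rintro x ⟨hx, hx'⟩ y hxy
    have hy : y ∈ T.side q e := Reachable.trans hx' hxy.reachable
    exact ⟨hS x hx' hx y (deleteEdges_adj.1 hxy).1 hy, hy⟩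

theorem IsAcyclic.side_disjoint (hT : T.IsAcyclic) {q e e' : W} (h : T.Adj q e) (h' : T.Adj q e')
    (hne : e ≠ e') : Disjoint (T.side q e) (T.side q e') := by
  rw [Set.disjoint_right]
  refine side_induction (S := (T.side q e)ᶜ) ?_ ?_
  · intro he'
    exact hne (hT.eq_of_leaves_side h he' (hT.notMem_side h) h'.symm).1.symm
  · intro x hx hxS y hxy _ hy
    obtain ⟨rfl, rfl⟩ := hT.eq_of_leaves_side h hy hxS hxy.symm
    exact hT.notMem_side h' hx

theorem IsAcyclic.side_disjoint_symm (hT : T.IsAcyclic) {q e : W} (h : T.Adj q e) :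
    Disjoint (T.side q e) (T.side e q) := by
  rw [Set.disjoint_right]
  refine side_induction (S := (T.side q e)ᶜ) (hT.notMem_side h) ?_
  intro x hx hxS y hxy _ hy
  obtain ⟨rfl, rfl⟩ := hT.eq_of_leaves_side h hy hxS hxy.symm
  exact absurd ‹y ∈ T.side y x› (hT.notMem_side h.symm)

theorem IsTree.mem_side_of_notMem (hT : T.IsTree) {q e w : W} (h : T.Adj q e)
    (hw : w ∉ T.side q e) : w ∈ T.side e q := by
  by_contra hw'
  have := (hT.connected.preconnected q w).mem_of_closed (S := T.side q e ∪ T.side e q) ?_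
    (Or.inr (mem_side_self _ _ _))
  · exact this.elim hw hw'
  · rintro x (hx | hx) y hxy
    · by_contra hy
      rw [Set.mem_union, not_or] at hy
      obtain ⟨rfl, rfl⟩ := hT.isAcyclic.eq_of_leaves_side h hx hy.1 hxy
      exact hy.2 (mem_side_self _ _ _)
    · by_contra hy
      rw [Set.mem_union, not_or] at hy
      obtain ⟨rfl, rfl⟩ := hT.isAcyclic.eq_of_leaves_side h.symm hx hy.2 hxy
      exact hy.1 (mem_side_self _ _ _)

theorem IsTree.exists_mem_side (hT : T.IsTree) {q w : W} (hne : w ≠ q) :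
    ∃ e, T.Adj q e ∧ w ∈ T.side q e := by
  have := (hT.connected.preconnected q w).mem_of_closed
    (S := {w | w = q ∨ ∃ e, T.Adj q e ∧ w ∈ T.side q e}) ?_ (Or.inl rfl)
  · exact this.resolve_left hne
  · rintro x (rfl | ⟨e, he, hx⟩) y hxy
    · exact Or.inr ⟨y, hxy, mem_side_self _ _ _⟩
    · by_cases hy : y ∈ T.side q e
      · exact Or.inr ⟨e, he, hy⟩
      · exact Or.inl (hT.isAcyclic.eq_of_leaves_side he hx hy hxy).2

/-- A set of vertices that induces a connected subgraph and meets both `S` and its complement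
contains an edge leaving `S`. -/
theorem Connected.exists_adj_leaving {P S : Set W} (hP : (T.induce P).Connected) {a b : W}
    (ha : a ∈ P) (haS : a ∈ S) (hb : b ∈ P) (hbS : b ∉ S) :
    ∃ x ∈ P, ∃ y ∈ P, x ∈ S ∧ y ∉ S ∧ T.Adj x y := by
  by_contra! hcon
  refine hbS ((hP.preconnected ⟨a, ha⟩ ⟨b, hb⟩).mem_of_closed (S := {x | x.1 ∈ S}) ?_ haS)
  intro x hx y hxy
  by_contra hy
  exact hcon x x.2 y y.2 hx hy hxy

theorem IsAcyclic.mem_of_crosses_side (hT : T.IsAcyclic) {P : Set W}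
    (hP : (T.induce P).Connected) {q e a b : W} (h : T.Adj q e) (ha : a ∈ P)
    (haS : a ∈ T.side q e) (hb : b ∈ P) (hbS : b ∉ T.side q e) : e ∈ P ∧ q ∈ P := by
  obtain ⟨x, hx, y, hy, hxS, hyS, hxy⟩ := hP.exists_adj_leaving ha haS hb hbS
  obtain ⟨rfl, rfl⟩ := hT.eq_of_leaves_side h hxS hyS hxy
  exact ⟨hx, hy⟩

/-- A connected set avoiding `q` lies on one side of an edge at `q`. -/
theorem IsTree.exists_subset_side (hT : T.IsTree) {P : Set W} (hP : (T.induce P).Connected)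
    {q : W} (hq : q ∉ P) : ∃ e, T.Adj q e ∧ P ⊆ T.side q e := by
  obtain ⟨⟨a, ha⟩⟩ := hP.nonempty
  obtain ⟨e, he, hae⟩ := hT.exists_mem_side (q := q) (w := a) (fun h => hq (h ▸ ha))
  refine ⟨e, he, fun b hb => ?_⟩
  by_contra hbS
  exact hq (hT.isAcyclic.mem_of_crosses_side hP he ha hae hb hbS).2

/-- The map need not be a homomorphism or onto: a contraction collapses edges, and a split replaces
an edge by a detour through a new vertex. -/
theorem Preconnected.of_map {A B : Type*} {G : SimpleGraph A} {H : SimpleGraph B}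
    (hG : G.Preconnected) (f : A → B) (hf : ∀ a b, G.Adj a b → H.Reachable (f a) (f b))
    (hs : ∀ y, ∃ a, H.Reachable (f a) y) : H.Preconnected := by
  have key : ∀ a b, H.Reachable (f a) (f b) := fun a b =>
    (hG a b).mem_of_closed (S := {x | H.Reachable (f a) (f x)})
      (fun x hx y hxy => Reachable.trans hx (hf _ _ hxy)) (Reachable.refl _)
  intro x y
  obtain ⟨a, ha⟩ := hs x
  obtain ⟨b, hb⟩ := hs y
  exact ha.symm.trans ((key a b).trans hb)

/-- An edge that alone crosses some cut is a bridge. For contracted and split trees the cuts come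
from sides of the original tree. -/
theorem isAcyclic_of_forall_cut
    (h : ∀ a b, T.Adj a b → ∃ S : Set W, (a ∈ S ↔ b ∉ S) ∧
      ∀ x y, x ∈ S → y ∉ S → T.Adj x y → s(x, y) = s(a, b)) : T.IsAcyclic := by
  rw [isAcyclic_iff_forall_adj_isBridge]
  intro a b hab hr
  obtain ⟨S, hS, hcut⟩ := h a b hab
  have hcl : ∀ x ∈ S, ∀ y, (T.deleteEdges {s(a, b)}).Adj x y → y ∈ S := by
    intro x hx y hxy
    rw [deleteEdges_adj] at hxy
    by_contra hy
    exact hxy.2 (hcut x y hx hy hxy.1)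
  by_cases ha : a ∈ S
  · exact hS.1 ha (Reachable.mem_of_closed hr hcl ha)
  · exact ha (Reachable.mem_of_closed hr.symm hcl (by tauto))

end SimpleGraph

/-! ### Path models and the Helly property -/

/-- `T` is a tree, and the sets `P v` induce paths of `T` whose intersection graph is `G`. -/
structure PathModel {V W : Type*} (G : SimpleGraph V) (T : SimpleGraph W) (P : V → Set W) :
    Prop where
  isTree : T.IsTree
  connected : ∀ v, (T.induce (P v)).Connected
  two_nbrs : ∀ v, ∀ x ∈ P v, ∀ a ∈ P v, ∀ b ∈ P v, ∀ c ∈ P v,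
    T.Adj x a → T.Adj x b → T.Adj x c → a = b ∨ a = c ∨ b = c
  adj_iff : ∀ u v, u ≠ v → (G.Adj u v ↔ (P u ∩ P v).Nonempty)

theorem Set.encard_le_two_iff {α : Type*} [Finite α] {s : Set α} :
    s.encard ≤ 2 ↔ ∀ a ∈ s, ∀ b ∈ s, ∀ c ∈ s, a = b ∨ a = c ∨ b = c := by
  have h := Set.two_lt_ncard (s := s)
  rw [← s.toFinite.cast_ncard_eq]
  have h2 : ((s.ncard : ℕ∞) ≤ 2) ↔ ¬ 2 < s.ncard := by
    rw [not_lt]; exact_mod_cast Iff.rfl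
  rw [h2, h]
  push Not
  constructor
  · intro h a ha b hb c hc
    have := h a ha b hb c hc
    tauto
  · intro h a ha b hb c hc
    have := h a ha b hb c hc
    tauto

theorem hasRepresentation_two_one_iff {V : Type*} {G : SimpleGraph V} {h : ℕ∞} :
    HasRepresentation h 2 1 G ↔ ∃ (W : Type) (_ : Finite W) (T : SimpleGraph W) (P : V → Set W),
      PathModel G T P ∧ ∀ x, (T.neighborSet x).encard ≤ h := by
  constructor
  · rintro ⟨W, hW, T, P, hT, hdeg, hP, hadj⟩
    refine ⟨W, hW, T, P, ⟨hT, fun v => (hP v).1.connected, fun v x hx a ha b hb c hc h1 h2 h3 => ?_,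
      fun u v huv => ?_⟩, hdeg⟩
    · have := Set.encard_le_two_iff.1 ((hP v).2 ⟨x, hx⟩) ⟨a, ha⟩ h1 ⟨b, hb⟩ h2 ⟨c, hc⟩ h3
      simpa using this
    · rw [hadj u v huv, Nat.cast_one, Set.one_le_encard_iff_nonempty]
  · rintro ⟨W, hW, T, P, hM, hdeg⟩
    refine ⟨W, hW, T, P, hM.isTree, hdeg, fun v => ⟨⟨hM.connected v,
      hM.isTree.isAcyclic.induce _⟩, fun x => ?_⟩, fun u v huv => ?_⟩
    · rw [Set.encard_le_two_iff]
      intro a ha b hb c hc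
      have := hM.two_nbrs v x x.2 a a.2 b b.2 c c.2 ha hb hc
      simpa [Subtype.ext_iff] using this
    · rw [hM.adj_iff u v huv, Nat.cast_one, Set.one_le_encard_iff_nonempty]

namespace PathModel

variable {V W : Type*} {G : SimpleGraph V} {T : SimpleGraph W} {P : V → Set W}

theorem nonempty (hM : PathModel G T P) (v : V) : (P v).Nonempty := by
  obtain ⟨⟨a, ha⟩⟩ := (hM.connected v).nonempty
  exact ⟨a, ha⟩

/-- The Helly property for the members of a clique. -/
theorem exists_common_vertex [Finite W] (hM : PathModel G T P) {C : Set V} (hC : G.IsClique C) :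
    ∃ q, ∀ c ∈ C, q ∈ P c := by
  classical
  by_contra! hcon
  have : ∀ q, ∃ c e, c ∈ C ∧ T.Adj q e ∧ P c ⊆ T.side q e := fun q => by
    obtain ⟨c, hc, hq⟩ := hcon q
    obtain ⟨e, he, hs⟩ := hM.isTree.exists_subset_side (hM.connected c) hq
    exact ⟨c, e, hc, he, hs⟩
  choose c e hc he hs using this
  have := Fintype.ofFinite W
  -- Each vertex selects an edge towards a path missing it. A tree has fewer edges than vertices, so
  -- some edge is selected from both its ends; the two paths then lie on opposite sides of it and
  -- are disjoint.
  obtain ⟨q, -, q', -, hne, heq⟩ := Finset.exists_ne_map_eq_of_card_lt_of_maps_to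
    (s := Finset.univ) (t := T.edgeFinset) (f := fun q => s(q, e q))
    (by rw [Finset.card_univ, ← hM.isTree.card_edgeFinset]; exact Nat.lt_succ_self _)
    (fun q _ => by simpa using he q)
  rcases Sym2.eq_iff.1 heq with ⟨h, -⟩ | ⟨h1, h2⟩
  · exact hne h
  · have hd := hM.isTree.isAcyclic.side_disjoint_symm (he q)
    have hs' := hs q'
    have hsq := hs q
    rw [← h1] at hs'
    rw [h2] at hd hsq
    have hPd : Disjoint (P (c q)) (P (c q')) := hd.mono hsq hs'
    obtain ⟨z, hz⟩ := hM.nonempty (c q)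
    by_cases hcc : c q = c q'
    · exact Set.disjoint_left.1 hPd hz (hcc ▸ hz)
    · obtain ⟨y, hy, hy'⟩ := (hM.adj_iff _ _ hcc).1 (hC (hc q) (hc q') hcc)
      exact Set.disjoint_left.1 hPd hy hy'

theorem isClique_mem (hM : PathModel G T P) (q : W) : G.IsClique {v | q ∈ P v} :=
  fun u hu v hv huv => (hM.adj_iff u v huv).2 ⟨q, hu, hv⟩

theorem mem_of_common_vertex (hM : PathModel G T P) {C : Set V} (hC : IsMaxClique G C) {q : W}
    (hq : ∀ c ∈ C, q ∈ P c) : C = {v | q ∈ P v} :=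
  Maximal.eq_of_subset hC (hM.isClique_mem q) hq

end PathModel

/-! ### Bounded degree gives colourings -/

namespace PathModel

open SimpleGraph

variable {V W : Type*} {G : SimpleGraph V} {T : SimpleGraph W} {P : V → Set W}

/-- A path containing `q` that meets a path inside `side q' e`, where `q` is not on this side,
contains `e` and `q'`. -/
theorem mem_of_meets (hM : PathModel G T P) {q q' e : W} {u v : V} (h : T.Adj q' e) (hu : q ∈ P u)
    (hq : q ∉ T.side q' e) (hv : P v ⊆ T.side q' e) (huv : (P u ∩ P v).Nonempty) :
    e ∈ P u ∧ q' ∈ P u := by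
  obtain ⟨z, hz, hz'⟩ := huv
  exact hM.isTree.isAcyclic.mem_of_crosses_side (hM.connected u) h hz (hv hz') hu hq

/-- Two paths on the same side of an edge at `q` cannot both be met by a path through `q` while
each of them is met by a path through `q` that misses the other. -/
theorem false_of_same_side [Finite W] (hM : PathModel G T P) {q : W} {v w c v' w' : V}
    (hc : q ∈ P c) (hv' : q ∈ P v') (hw' : q ∈ P w')
    (hcv : (P c ∩ P v).Nonempty) (hcw : (P c ∩ P w).Nonempty)
    (hv'v : (P v' ∩ P v).Nonempty) (hv'w : ¬ (P v' ∩ P w).Nonempty)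
    (hw'w : (P w' ∩ P w).Nonempty) (hw'v : ¬ (P w' ∩ P v).Nonempty)
    {x y : W} (hxy : T.Adj x y) (hq : q ∉ T.side x y)
    (hv : P v ⊆ T.side x y) (hw : P w ⊆ T.side x y) : False := by
  induction hn : (T.side x y).ncard using Nat.strong_induction_on generalizing x y with
  | _ n ih =>
    have hac := hM.isTree.isAcyclic
    -- To reach `P w` from `q`, the path `P w'` passes through `y`, so `P v` cannot contain `y`;
    -- symmetrically for `P w`.
    have hyv : y ∉ P v := fun hy =>
      hw'v ⟨y, (hM.mem_of_meets hxy hw' hq hw hw'w).1, hy⟩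
    have hyw : y ∉ P w := fun hy =>
      hv'w ⟨y, (hM.mem_of_meets hxy hv' hq hv hv'v).1, hy⟩
    have hqx : q ∈ T.side y x := hM.isTree.mem_side_of_notMem hxy hq
    have hd := hac.side_disjoint_symm hxy
    obtain ⟨hyc, hxc⟩ := hM.mem_of_meets hxy hc hq hv hcv
    have key : ∀ u, P u ⊆ T.side x y → y ∉ P u → (P c ∩ P u).Nonempty →
        ∃ a, T.Adj y a ∧ P u ⊆ T.side y a ∧ x ≠ a ∧ a ∈ P c ∧ q ∉ T.side y a := by
      intro u hu hyu hcu
      obtain ⟨a, ha, hs⟩ := hM.isTree.exists_subset_side (hM.connected u) hyu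
      have hxa : x ≠ a := by
        rintro rfl
        obtain ⟨z, hz⟩ := hM.nonempty u
        exact Set.disjoint_left.1 hd (hu hz) (hs hz)
      have hqa : q ∉ T.side y a :=
        Set.disjoint_left.1 (hac.side_disjoint hxy.symm ha hxa) hqx
      exact ⟨a, ha, hs, hxa, (hM.mem_of_meets ha hc hqa hs hcu).1, hqa⟩
    obtain ⟨a, ha, hsa, hxa, hac', hqa⟩ := key v hv hyv hcv
    obtain ⟨b, hb, hsb, hxb, hbc, -⟩ := key w hw hyw hcw
    -- The path `P c` enters `y` from `x` and has only one way on, so `P v` and `P w` lie behind the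
    -- same next edge, on a strictly smaller side.
    rcases hM.two_nbrs c y hyc x hxc a hac' b hbc hxy.symm ha hb with h | h | rfl
    · exact hxa h
    · exact hxb h
    · refine ih _ ?_ ha hqa hsa hsb rfl
      rw [← hn]
      refine Set.ncard_lt_ncard ⟨fun z hz => ?_, fun hsub => ?_⟩
      · by_contra hz'
        exact Set.disjoint_left.1 (hac.side_disjoint hxy.symm ha hxa)
          (hM.isTree.mem_side_of_notMem hxy hz') hz
      · exact hac.notMem_side ha (hsub (mem_side_self T x y))

theorem branchGraph_colorable [Finite W] (hM : PathModel G T P) {h : ℕ}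
    (hdeg : ∀ x, (T.neighborSet x).encard ≤ h) {C : Set V} (hC : IsMaxClique G C) :
    (branchGraph G C).Colorable h := by
  classical
  obtain ⟨q, hq⟩ := hM.exists_common_vertex hC.1
  have hCq := hM.mem_of_common_vertex hC hq
  have hmem : ∀ u, u ∈ C ↔ q ∈ P u := fun u => by rw [hCq]; rfl
  have hside : ∀ v : branchVerts G C, ∃ e, T.Adj q e ∧ P v ⊆ T.side q e := fun v =>
    hM.isTree.exists_subset_side (hM.connected v) (fun hv => v.2.1 ((hmem _).2 hv))
  choose e he hs using hside
  have hcol : (branchGraph G C).Coloring (T.neighborSet q) := by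
    refine Coloring.mk (fun v => ⟨e v, he v⟩) ?_
    rintro v w ⟨-, ⟨c, hc, hcv, hcw⟩, v', hv', w', hw', ⟨h1, h2⟩, h3, h4⟩ heq
    have heq : e v = e w := congrArg Subtype.val heq
    have ne : ∀ {u} (z : branchVerts G C), u ∈ C → u ≠ z := fun z hu h => z.2.1 (h ▸ hu)
    refine hM.false_of_same_side (v := v) (w := w) ((hmem c).1 hc) ((hmem v').1 hv')
      ((hmem w').1 hw')
      ((hM.adj_iff _ _ (ne v hc)).1 hcv) ((hM.adj_iff _ _ (ne w hc)).1 hcw)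
      ((hM.adj_iff _ _ (ne v hv')).1 h1) (mt (hM.adj_iff _ _ (ne w hv')).2 h2)
      ((hM.adj_iff _ _ (ne w hw')).1 h3) (mt (hM.adj_iff _ _ (ne v hw')).2 h4)
      (he v) (hM.isTree.isAcyclic.notMem_side (he v)) (hs v) (heq ▸ hs w)
  have := Fintype.ofFinite (T.neighborSet q)
  refine hcol.colorable.mono ?_
  have hd := hdeg q
  rw [← (Set.toFinite (T.neighborSet q)).cast_ncard_eq] at hd
  rw [← Nat.card_eq_fintype_card, Nat.card_coe_set_eq]
  exact_mod_cast hd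

end PathModel

/-! ### Contracting redundant edges -/

namespace SimpleGraph

variable {W : Type*} {T : SimpleGraph W}

open Classical in
/-- The retraction of `W` onto `W \ {e}` that sends `e` to its neighbour `q`. -/
noncomputable def contractFun {q e : W} (h : T.Adj q e) (w : W) : {w // w ≠ e} :=
  if hw : w = e then ⟨q, h.ne⟩ else ⟨w, hw⟩

theorem contractFun_self {q e : W} (h : T.Adj q e) : contractFun h e = ⟨q, h.ne⟩ := by
  simp [contractFun]

theorem contractFun_of_ne {q e : W} (h : T.Adj q e) {w : W} (hw : w ≠ e) :
    contractFun h w = ⟨w, hw⟩ := by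
  simp [contractFun, hw]

theorem contractFun_val {q e : W} (h : T.Adj q e) (w : {w // w ≠ e}) : contractFun h w = w :=
  contractFun_of_ne h w.2

theorem eq_or_adj_of_contractFun_eq {q e : W} (h : T.Adj q e) {a b : W}
    (hab : contractFun h a = contractFun h b) : a = b ∨ T.Adj a b := by
  by_cases ha : a = e <;> by_cases hb : b = e
  · exact Or.inl (ha.trans hb.symm)
  · subst ha
    rw [contractFun_self, contractFun_of_ne h hb, Subtype.mk.injEq] at hab
    exact Or.inr (hab ▸ h.symm)
  · subst hb
    rw [contractFun_self, contractFun_of_ne h ha, Subtype.mk.injEq] at hab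
    exact Or.inr (hab ▸ h)
  · rw [contractFun_of_ne h ha, contractFun_of_ne h hb, Subtype.mk.injEq] at hab
    exact Or.inl hab

/-- The graph obtained from `T` by contracting the edge `q e` into `q`. -/
def contractEdge {q e : W} (h : T.Adj q e) : SimpleGraph {w // w ≠ e} where
  Adj u v := u ≠ v ∧ ∃ a b, contractFun h a = u ∧ contractFun h b = v ∧ T.Adj a b
  symm := ⟨fun _ _ ⟨hne, a, b, ha, hb, hab⟩ => ⟨hne.symm, b, a, hb, ha, hab.symm⟩⟩
  loopless := ⟨fun _ h => h.1 rfl⟩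

theorem IsTree.contractEdge {q e : W} (hT : T.IsTree) (h : T.Adj q e) :
    (contractEdge h).IsTree := by
  have hac := hT.isAcyclic
  have : Nonempty {w // w ≠ e} := ⟨⟨q, h.ne⟩⟩
  refine ⟨⟨hT.connected.preconnected.of_map (contractFun h) (fun a b hab => ?_)
    fun y => ⟨y, by rw [contractFun_val]⟩⟩, isAcyclic_of_forall_cut ?_⟩
  · by_cases hf : contractFun h a = contractFun h b
    · rw [hf]
    · exact Adj.reachable ⟨hf, a, b, rfl, rfl, hab⟩
  · rintro u v ⟨huv, a, b, rfl, rfl, hab⟩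
    have hmem : ∀ z, (contractFun h z).1 ∈ T.side b a ↔ z ∈ T.side b a := by
      intro z
      by_cases hz : z = e
      · subst hz
        rw [contractFun_self]
        by_contra hne
        -- The only edge separating the ends of the contracted edge is that edge itself, so every
        -- other cut survives the contraction.
        have hab' : s(q, z) = s(a, b) := by
          by_cases hq : q ∈ T.side b a
          · obtain ⟨rfl, rfl⟩ := hac.eq_of_leaves_side hab.symm hq (by tauto) h
            rfl
          · obtain ⟨rfl, rfl⟩ := hac.eq_of_leaves_side hab.symm (by tauto) hq h.symm
            exact Sym2.eq_swap
        have hqz : contractFun h q = contractFun h z := by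
          rw [contractFun_self, contractFun_of_ne]
        rcases Sym2.eq_iff.1 hab' with ⟨rfl, rfl⟩ | ⟨rfl, rfl⟩
        · exact huv hqz
        · exact huv hqz.symm
      · rw [contractFun_of_ne h hz]
    refine ⟨{w | w.1 ∈ T.side b a}, ?_, ?_⟩
    · have h1 : a ∈ T.side b a := mem_side_self _ _ _
      have h2 : b ∉ T.side b a := hac.notMem_side hab.symm
      simp only [Set.mem_ofPred_eq, hmem]
      tauto
    · rintro x y hx hy ⟨hxy, a', b', rfl, rfl, hab'⟩
      simp only [Set.mem_ofPred_eq, hmem] at hx hy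
      obtain ⟨rfl, rfl⟩ := hac.eq_of_leaves_side hab.symm hx hy hab'
      rfl

end SimpleGraph

namespace PathModel

open SimpleGraph

variable {V W : Type*} {G : SimpleGraph V} {T : SimpleGraph W} {P : V → Set W}

/-- As every path through `e` contains `q`, removing `e` from a path is the same as taking its image
under the contraction, and no intersection becomes empty. -/
theorem contractEdge (hM : PathModel G T P) {q e : W} (h : T.Adj q e)
    (hP : ∀ v, e ∈ P v → q ∈ P v) :
    PathModel G (contractEdge h) (fun v => {w | w.1 ∈ P v}) := by
  have hac := hM.isTree.isAcyclic
  have hmem : ∀ v z, z ∈ P v → (contractFun h z).1 ∈ P v := by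
    intro v z hz
    by_cases hze : z = e
    · subst hze
      rw [contractFun_self]
      exact hP v hz
    · rwa [contractFun_of_ne h hze]
  have hcross : ∀ v a, q ∈ P v → a ∈ P v → a ≠ q → T.Adj e a → e ∈ P v := by
    intro v a hq ha haq hea
    refine (hac.mem_of_crosses_side (hM.connected v) h ha ?_ hq (hac.notMem_side h)).1
    by_contra haS
    exact haq (hac.eq_of_leaves_side h (mem_side_self _ _ _) haS hea).2
  have hlift : ∀ v (x a : {w // w ≠ e}), x.1 ∈ P v → a.1 ∈ P v → (SimpleGraph.contractEdge h).Adj x a →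
      ∃ x₀ ∈ P v, ∃ a₀ ∈ P v, contractFun h x₀ = x ∧ contractFun h a₀ = a ∧ T.Adj x₀ a₀ := by
    rintro v x a hx ha ⟨hxa, x₀, a₀, rfl, rfl, hadj⟩
    have hx₀ : x₀ ∈ P v := by
      by_cases hxe : x₀ = e
      · subst hxe
        have hae : a₀ ≠ x₀ := hadj.ne'
        rw [contractFun_self] at hx hxa
        rw [contractFun_of_ne h hae] at ha hxa
        exact hcross v a₀ hx ha (fun h => hxa (Subtype.ext h.symm)) hadj
      · rwa [contractFun_of_ne h hxe] at hx
    have ha₀ : a₀ ∈ P v := by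
      by_cases hae : a₀ = e
      · subst hae
        have hxe : x₀ ≠ a₀ := hadj.ne
        rw [contractFun_self] at ha hxa
        rw [contractFun_of_ne h hxe] at hx hxa
        exact hcross v x₀ ha hx (fun h => hxa (Subtype.ext h)) hadj.symm
      · rwa [contractFun_of_ne h hae] at ha
    exact ⟨x₀, hx₀, a₀, ha₀, rfl, rfl, hadj⟩
  refine ⟨hM.isTree.contractEdge h, fun v => ?_, ?_, ?_⟩
  · have : Nonempty {w : {w // w ≠ e} | w.1 ∈ P v} := by
      obtain ⟨z, hz⟩ := hM.nonempty v
      exact ⟨⟨contractFun h z, hmem v z hz⟩⟩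
    refine ⟨(hM.connected v).preconnected.of_map
      (fun z => ⟨contractFun h z, hmem v z z.2⟩) (fun a b hab => ?_) fun y => ⟨⟨y, y.2⟩, ?_⟩⟩
    · by_cases hf : contractFun h a = contractFun h b
      · simp only [hf]; exact Reachable.refl _
      · exact Adj.reachable ⟨hf, a, b, rfl, rfl, hab⟩
    · simp only [contractFun_val]; exact Reachable.refl _
  · rintro v x hx a ha b hb c hc hxa hxb hxc
    obtain ⟨x₀, hx₀, a₀, ha₀, hx₀', rfl, had₀⟩ := hlift v x a hx ha hxa
    obtain ⟨x₁, hx₁, b₀, hb₀, hx₁', rfl, had₁⟩ := hlift v x b hx hb hxb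
    obtain ⟨x₂, hx₂, c₀, hc₀, hx₂', rfl, had₂⟩ := hlift v x c hx hc hxc
    have h01 := eq_or_adj_of_contractFun_eq h (hx₀'.trans hx₁'.symm)
    have h02 := eq_or_adj_of_contractFun_eq h (hx₀'.trans hx₂'.symm)
    have h12 := eq_or_adj_of_contractFun_eq h (hx₁'.trans hx₂'.symm)
    -- Here `s` and `t` are the two ends of the contracted edge, both on the path. At `t` one of the
    -- two path directions is taken by `s`, so the other two edges coincide.
    have key : ∀ s t a b, s ∈ P v → t ∈ P v → a ∈ P v → b ∈ P v → contractFun h s = x →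
        contractFun h t = x → x ≠ contractFun h a → x ≠ contractFun h b → T.Adj t a → T.Adj t b →
        T.Adj t s → contractFun h a = contractFun h b := by
      intro s t a b hs ht ha hb hsx htx hxa hxb hta htb hts
      rcases hM.two_nbrs v t ht a ha b hb s hs hta htb hts with rfl | rfl | rfl
      · rfl
      · exact absurd hsx.symm hxa
      · exact absurd hsx.symm hxb
    rcases h01 with rfl | h01
    · rcases h02 with rfl | h02
      · rcases hM.two_nbrs v x₀ hx₀ a₀ ha₀ b₀ hb₀ c₀ hc₀ had₀ had₁ had₂ with rfl | rfl | rfl <;> simp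
      · exact Or.inl (key x₂ x₀ a₀ b₀ hx₂ hx₀ ha₀ hb₀ hx₂' hx₀' hxa.1 hxb.1 had₀ had₁ h02)
    · rcases h02 with rfl | h02
      · exact Or.inr (Or.inl
          (key x₁ x₀ a₀ c₀ hx₁ hx₀ ha₀ hc₀ hx₁' hx₀' hxa.1 hxc.1 had₀ had₂ h01))
      · rcases h12 with rfl | h12
        · exact Or.inr (Or.inr
            (key x₀ x₁ b₀ c₀ hx₀ hx₁ hb₀ hc₀ hx₀' hx₁' hxb.1 hxc.1 had₁ had₂ h01.symm))
        -- Three pairwise distinct preimages of `x` are impossible: only `e` and `x` itself can map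
        -- to `x`.
        · exfalso
          have h2 : ∀ z, contractFun h z = x → z = e ∨ z = x.1 := by
            rintro z rfl
            by_cases hz : z = e
            · exact Or.inl hz
            · exact Or.inr (by rw [contractFun_of_ne h hz])
          rcases h2 _ hx₀' with r0 | r0 <;> rcases h2 _ hx₁' with r1 | r1 <;>
            rcases h2 _ hx₂' with r2 | r2 <;> first
            | exact h01.ne (r0.trans r1.symm)
            | exact h02.ne (r0.trans r2.symm)
            | exact h12.ne (r1.trans r2.symm)
  · intro u v huv
    rw [hM.adj_iff u v huv]
    constructor
    · rintro ⟨z, hz, hz'⟩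
      exact ⟨contractFun h z, hmem u z hz, hmem v z hz'⟩
    · rintro ⟨z, hz, hz'⟩
      exact ⟨z, hz, hz'⟩

/-- Contracting edges leads to a model in which no vertex is dominated by a neighbour. -/
theorem exists_irredundant {V : Type*} {G : SimpleGraph V} {W : Type} [Finite W]
    {T : SimpleGraph W} {P : V → Set W} (hM : PathModel G T P) :
    ∃ (W' : Type) (_ : Finite W') (T' : SimpleGraph W') (P' : V → Set W'), PathModel G T' P' ∧
      ∀ q e, T'.Adj q e → ∃ v, e ∈ P' v ∧ q ∉ P' v := by
  induction hn : Nat.card W using Nat.strong_induction_on generalizing W with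
  | _ n ih =>
    by_cases hall : ∀ q e, T.Adj q e → ∃ v, e ∈ P v ∧ q ∉ P v
    · exact ⟨W, inferInstance, T, P, hM, hall⟩
    · push Not at hall
      obtain ⟨q, e, h, hP⟩ := hall
      refine ih _ ?_ (hM.contractEdge h hP) rfl
      rw [← hn]
      have := Fintype.ofFinite W
      classical
      rw [Nat.card_eq_fintype_card, Nat.card_eq_fintype_card]
      exact Fintype.card_subtype_lt (x := e) (by simp)

end PathModel

/-! ### Colouring the neighbours of a vertex -/

namespace SimpleGraph

/-- A colouring of all vertices but some of degree at most one extends. -/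
theorem exists_extend_coloring {N : Type*} [Finite N] (K : SimpleGraph N) {h : ℕ} (hh : 2 ≤ h)
    (S : Set N) (hS : ∀ s ∈ S, (K.neighborSet s).Subsingleton) (f : N → Fin h)
    (hf : ∀ a ∉ S, ∀ b ∉ S, K.Adj a b → f a ≠ f b) :
    ∃ g : N → Fin h, ∀ a b, K.Adj a b → g a ≠ g b := by
  classical
  induction S, S.toFinite using Set.Finite.induction_on generalizing f with
  | empty => exact ⟨f, fun a b => hf a id b id⟩
  | @insert s S hs _ ih =>
    obtain ⟨c, hc⟩ : ∃ c : Fin h, ∀ b, K.Adj s b → c ≠ f b := by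
      by_cases hb : ∃ b, K.Adj s b
      · obtain ⟨b, hb⟩ := hb
        have : Nontrivial (Fin h) := Fin.nontrivial_iff_two_le.2 hh
        obtain ⟨c, hc⟩ := exists_ne (f b)
        refine ⟨c, fun b' hb' => ?_⟩
        rwa [hS s (Set.mem_insert _ _) hb' hb]
      · exact ⟨⟨0, by omega⟩, fun b hb' => absurd ⟨b, hb'⟩ hb⟩
    refine ih (fun t ht => hS t (Set.mem_insert_of_mem _ ht)) (Function.update f s c) ?_
    intro a ha b hb hab
    by_cases has : a = s
    · subst has
      rw [Function.update_self, Function.update_of_ne hab.ne']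
      exact hc b hab
    · by_cases hbs : b = s
      · subst hbs
        rw [Function.update_self, Function.update_of_ne has]
        exact (hc a hab.symm).symm
      · rw [Function.update_of_ne has, Function.update_of_ne hbs]
        exact hf a (by simp [has, ha]) b (by simp [hbs, hb]) hab

end SimpleGraph

namespace PathModel

open SimpleGraph

variable {V W : Type*} {G : SimpleGraph V} {T : SimpleGraph W} {P : V → Set W}

/-- A larger clique would have a common vertex `q' ≠ q`. Irredundancy gives a path through `q`
missing the neighbour of `q` towards `q'`; it belongs to the clique but cannot reach `q'`. -/
theorem isMaxClique_mem [Finite V] [Finite W] (hM : PathModel G T P)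
    (hirr : ∀ q e, T.Adj q e → ∃ v, e ∈ P v ∧ q ∉ P v) (q : W) :
    IsMaxClique G {v | q ∈ P v} := by
  obtain ⟨C, hle, hC⟩ := (Set.toFinite {S : Set V | G.IsClique S}).exists_le_maximal
    (hM.isClique_mem q)
  have hC : IsMaxClique G C := hC
  obtain ⟨q', hq'⟩ := hM.exists_common_vertex hC.1
  have hCq' := hM.mem_of_common_vertex hC hq'
  by_cases hqq : q' = q
  · subst hqq
    rwa [← hCq']
  · exfalso
    obtain ⟨e, he, hs⟩ := hM.isTree.exists_mem_side hqq
    obtain ⟨v, hv, hv'⟩ := hirr e q he.symm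
    exact hv' (hM.isTree.isAcyclic.mem_of_crosses_side (hM.connected v) he (hq' v (hle hv)) hs hv
      (hM.isTree.isAcyclic.notMem_side he)).1

/-- Colours for the neighbours of `q` such that no path runs through `q` between two neighbours of
the same colour. -/
theorem exists_nbr_coloring [Finite V] [Finite W] (hM : PathModel G T P)
    (hirr : ∀ q e, T.Adj q e → ∃ v, e ∈ P v ∧ q ∉ P v) {h : ℕ} (hh : 2 ≤ h)
    (hcol : ∀ C : Set V, IsMaxClique G C → (branchGraph G C).Colorable h) (q : W) :
    ∃ f : W → Fin h, ∀ i j, i ≠ j → T.Adj q i → T.Adj q j →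
      (∃ v, q ∈ P v ∧ i ∈ P v ∧ j ∈ P v) → f i ≠ f j := by
  classical
  have hac := hM.isTree.isAcyclic
  have hmax := hM.isMaxClique_mem hirr q
  obtain ⟨g⟩ := hcol _ hmax
  obtain _ | _ := isEmpty_or_nonempty V
  · exact ⟨fun _ => ⟨0, by omega⟩, fun _ _ _ _ _ ⟨v, _⟩ => isEmptyElim v⟩
  -- `P (r i)` contains `i` but not `q`, hence lies behind the edge `q i`; a path through `q` meets
  -- it exactly when it contains `i`.
  choose! r hr hr' using hirr q
  let K : SimpleGraph W :=
    { Adj := fun i j => i ≠ j ∧ T.Adj q i ∧ T.Adj q j ∧ ∃ v, q ∈ P v ∧ i ∈ P v ∧ j ∈ P v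
      symm := ⟨fun i j ⟨h1, h2, h3, v, h4, h5, h6⟩ => ⟨h1.symm, h3, h2, v, h4, h6, h5⟩⟩
      loopless := ⟨fun i h => h.1 rfl⟩ }
  have hrside : ∀ i, T.Adj q i → P (r i) ⊆ T.side q i := by
    intro i hi z hz
    by_contra hz'
    exact hr' i hi (hac.mem_of_crosses_side (hM.connected _) hi (hr i hi)
      (mem_side_self _ _ _) hz hz').2
  have hne : ∀ i v, T.Adj q i → q ∈ P v → v ≠ r i := fun i v hi hv h => hr' i hi (h ▸ hv)
  have hadj : ∀ i v, T.Adj q i → q ∈ P v → (G.Adj v (r i) ↔ i ∈ P v) := by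
    intro i v hi hv
    rw [hM.adj_iff _ _ (hne i v hi hv)]
    exact ⟨fun hz => (hM.mem_of_meets hi hv (hac.notMem_side hi) (hrside i hi) hz).1,
      fun hiv => ⟨i, hiv, hr i hi⟩⟩
  have hbranch : ∀ i v, T.Adj q i → q ∈ P v → i ∈ P v → r i ∈ branchVerts G {v | q ∈ P v} :=
    fun i v hi hv hiv => ⟨hr' i hi, v, hv, (hadj i v hi hv).2 hiv⟩
  -- This supplies condition (3) of the branch graph: if `i` also conflicts with some `k ≠ j`, the
  -- path witnessing this leaves `q` by `i` and `k`, so it misses `j`.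
  have hsub : ∀ i j, ¬ (K.neighborSet i).Subsingleton → K.Adj i j →
      ∃ v, q ∈ P v ∧ i ∈ P v ∧ j ∉ P v := by
    intro i j hi hij
    by_contra! hcon
    refine hi (Set.subsingleton_of_forall_eq j ?_)
    rintro k ⟨hik, hqi, hqk, v, hqv, hiv, hkv⟩
    rcases hM.two_nbrs v q hqv i hiv j (hcon v hqv hiv) k hkv hqi hij.2.2.1 hqk with h | h | h
    · exact absurd h hij.1
    · exact absurd h hik
    · exact h.symm
  -- Condition (3) can fail at a neighbour with at most one conflict, but such neighbours are
  -- coloured greedily. The default colour `0` only occurs where no path contains both `q` and `i`,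
  -- so that `i` has no conflict at all.
  obtain ⟨f, hf⟩ := K.exists_extend_coloring hh {i | (K.neighborSet i).Subsingleton}
    (fun _ h => h)
    (fun i => if hi : r i ∈ branchVerts G {v | q ∈ P v} then g ⟨r i, hi⟩ else ⟨0, by omega⟩)
    (by
      intro i hi j hj hij
      obtain ⟨vi, hqi', hvi, hvi'⟩ := hsub i j hi hij
      obtain ⟨vj, hqj', hvj, hvj'⟩ := hsub j i hj hij.symm
      obtain ⟨hne', hqi, hqj, v, hqv, hiv, hjv⟩ := hij
      simp only [dif_pos (hbranch i v hqi hqv hiv), dif_pos (hbranch j v hqj hqv hjv)]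
      refine g.valid ⟨?_, ⟨v, hqv, (hadj i v hqi hqv).2 hiv, (hadj j v hqj hqv).2 hjv⟩,
        vi, hqi', vj, hqj', ⟨(hadj i vi hqi hqi').2 hvi, mt (hadj j vi hqj hqi').1 hvi'⟩,
        (hadj j vj hqj hqj').2 hvj, mt (hadj i vj hqi hqj').1 hvj'⟩
      intro hG
      obtain ⟨z, hz, hz'⟩ := (hM.adj_iff _ _ hG.ne).1 hG
      exact Set.disjoint_left.1 (hac.side_disjoint hqi hqj hne') (hrside i hqi hz)
        (hrside j hqj hz'))
  exact ⟨f, fun i j hij hi hj hv => hf i j ⟨hij, hi, hj, hv⟩⟩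

end PathModel

/-! ### Splitting a vertex -/

namespace SimpleGraph

variable {W : Type*} {T : SimpleGraph W}

/-- The graph obtained from `T` by replacing the edges `q i` and `q j` by a new vertex adjacent to
`q`, `i` and `j`. -/
def splitVertex (T : SimpleGraph W) (q i j : W) : SimpleGraph (Option W) where
  Adj
    | none, none => False
    | none, some b => b = q ∨ b = i ∨ b = j
    | some a, none => a = q ∨ a = i ∨ a = j
    | some a, some b => T.Adj a b ∧ s(a, b) ≠ s(q, i) ∧ s(a, b) ≠ s(q, j)
  symm := ⟨by
    rintro (_ | a) (_ | b) h
    · exact h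
    · exact h
    · exact h
    · exact ⟨h.1.symm, by rw [Sym2.eq_swap]; exact h.2.1, by rw [Sym2.eq_swap]; exact h.2.2⟩⟩
  loopless := ⟨by
    rintro (_ | a) h
    · exact h
    · exact h.1.ne rfl⟩

variable {q i j : W}

@[simp] theorem splitVertex_adj_none_some {b : W} :
    (T.splitVertex q i j).Adj none (some b) ↔ b = q ∨ b = i ∨ b = j := Iff.rfl

@[simp] theorem splitVertex_adj_some_none {b : W} :
    (T.splitVertex q i j).Adj (some b) none ↔ b = q ∨ b = i ∨ b = j := Iff.rfl

@[simp] theorem splitVertex_adj_none_none : ¬ (T.splitVertex q i j).Adj none none := fun h => h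

@[simp] theorem splitVertex_adj_some_some {a b : W} :
    (T.splitVertex q i j).Adj (some a) (some b) ↔
      T.Adj a b ∧ s(a, b) ≠ s(q, i) ∧ s(a, b) ≠ s(q, j) := Iff.rfl

/-- Reading `none` as `q`, by `getD q`, contracts the new vertex back. Away from `q` this maps
neighbours to neighbours injectively, so nothing changes there. -/
theorem splitVertex_adj_getD (hi : T.Adj q i) (hj : T.Adj q j) {x : W} (hxq : x ≠ q) {a : Option W}
    (h : (T.splitVertex q i j).Adj (some x) a) : T.Adj x (a.getD q) := by
  rcases a with _ | a
  · rcases h with rfl | rfl | rfl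
    · exact absurd rfl hxq
    · exact hi.symm
    · exact hj.symm
  · exact h.1

theorem splitVertex_getD_inj {x : W} (hxq : x ≠ q) {a b : Option W}
    (h1 : (T.splitVertex q i j).Adj (some x) a) (h2 : (T.splitVertex q i j).Adj (some x) b)
    (h3 : a.getD q = b.getD q) : a = b := by
  have hxi : x = i ∨ x = j → s(x, q) = s(q, i) ∨ s(x, q) = s(q, j) := by
    rintro (rfl | rfl)
    · exact Or.inl Sym2.eq_swap
    · exact Or.inr Sym2.eq_swap
  rcases a with _ | a <;> rcases b with _ | b
  · rfl
  · obtain rfl : q = b := h3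
    exact ((hxi (h1.resolve_left hxq)).elim h2.2.1 h2.2.2).elim
  · obtain rfl : a = q := h3
    exact ((hxi (h2.resolve_left hxq)).elim h1.2.1 h1.2.2).elim
  · exact congrArg some h3

/-- The neighbours of `q` in the split graph that are old vertices. -/
theorem splitVertex_adj_self {a : W} (h : (T.splitVertex q i j).Adj (some q) (some a)) :
    T.Adj q a ∧ a ≠ i ∧ a ≠ j :=
  ⟨h.1, by rintro rfl; exact h.2.1 rfl, by rintro rfl; exact h.2.2 rfl⟩

theorem IsTree.splitVertex (hT : T.IsTree) (hi : T.Adj q i) (hj : T.Adj q j) :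
    (T.splitVertex q i j).IsTree := by
  have hac := hT.isAcyclic
  have hq0 : (T.splitVertex q i j).Adj (some q) none := by simp
  have hi0 : (T.splitVertex q i j).Adj (some i) none := by simp
  have hj0 : (T.splitVertex q i j).Adj (some j) none := by simp
  refine ⟨⟨hT.connected.preconnected.of_map some (fun a b hab => ?_) ?_⟩,
    isAcyclic_of_forall_cut ?_⟩
  · by_cases h1 : s(a, b) = s(q, i)
    · rcases Sym2.eq_iff.1 h1 with ⟨rfl, rfl⟩ | ⟨rfl, rfl⟩
      · exact hq0.reachable.trans hi0.symm.reachable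
      · exact hi0.reachable.trans hq0.symm.reachable
    by_cases h2 : s(a, b) = s(q, j)
    · rcases Sym2.eq_iff.1 h2 with ⟨rfl, rfl⟩ | ⟨rfl, rfl⟩
      · exact hq0.reachable.trans hj0.symm.reachable
      · exact hj0.reachable.trans hq0.symm.reachable
    exact Adj.reachable ⟨hab, h1, h2⟩
  · rintro (_ | y)
    · exact ⟨q, hq0.reachable⟩
    · exact ⟨y, Reachable.refl _⟩
  · have hval : ∀ x y, (T.splitVertex q i j).Adj x y → s(x, y) ≠ s(none, some q) →
        T.Adj (x.getD q) (y.getD q) := by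
      rintro (_ | x) (_ | y) hxy hne
      · exact absurd hxy (by simp)
      · rcases hxy with rfl | rfl | rfl
        · exact absurd rfl hne
        · exact hi
        · exact hj
      · rcases hxy with rfl | rfl | rfl
        · exact absurd Sym2.eq_swap hne
        · exact hi.symm
        · exact hj.symm
      · exact hxy.1
    have hinj : ∀ x y a b, (T.splitVertex q i j).Adj x y → (T.splitVertex q i j).Adj a b →
        x.getD q ≠ y.getD q → x.getD q = a.getD q → y.getD q = b.getD q → s(x, y) = s(a, b) := by
      rintro (_ | x) (_ | y) (_ | a) (_ | b) h1 h2 h3 h4 h5 <;>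
        simp only [Option.getD_none, Option.getD_some, splitVertex_adj_none_some,
          splitVertex_adj_none_none, splitVertex_adj_some_none, splitVertex_adj_some_some] at * <;>
        grind
    intro a b hab
    by_cases hs : s(a, b) = s(none, some q)
    · refine ⟨{z | z.elim True (fun w => w ∈ T.side q i ∪ T.side q j)}, ?_, ?_⟩
      · have : q ∉ T.side q i ∪ T.side q j :=
          fun h => h.elim (hac.notMem_side hi) (hac.notMem_side hj)
        rcases Sym2.eq_iff.1 hs with ⟨rfl, rfl⟩ | ⟨rfl, rfl⟩ <;> simpa using this
      · have h1 : ∀ k, T.Adj q k → ∀ x ∈ T.side q k, ∀ y ∉ T.side q k, T.Adj x y →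
            s(x, y) ≠ s(q, k) → False := by
          intro k hk x hx y hy hxy hne
          obtain ⟨rfl, rfl⟩ := hac.eq_of_leaves_side hk hx hy hxy
          exact hne Sym2.eq_swap
        have hii := mem_side_self T q i
        have hjj := mem_side_self T q j
        rintro (_ | x) (_ | y) hx hy hxy
        · exact absurd trivial hy
        · rcases hxy with rfl | rfl | rfl
          · exact hs.symm
          · exact absurd (Or.inl hii) hy
          · exact absurd (Or.inr hjj) hy
        · exact absurd trivial hy
        · exfalso
          rcases hx with hx | hx
          · exact h1 i hi x hx y (fun h => hy (Or.inl h)) hxy.1 hxy.2.1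
          · exact h1 j hj x hx y (fun h => hy (Or.inr h)) hxy.1 hxy.2.2
    · have hab' := hval a b hab hs
      have ha : a.getD q ∈ T.side (b.getD q) (a.getD q) := mem_side_self _ _ _
      have hb : b.getD q ∉ T.side (b.getD q) (a.getD q) := hac.notMem_side hab'.symm
      refine ⟨{z | z.getD q ∈ T.side (b.getD q) (a.getD q)}, ?_, ?_⟩
      · simp only [Set.mem_ofPred_eq]
        tauto
      · intro x y hx hy hxy
        have hne : x.getD q ≠ y.getD q := fun h => hy (by
          simp only [Set.mem_ofPred_eq] at hx ⊢; rwa [← h])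
        have hs' : s(x, y) ≠ s(none, some q) := by
          intro h
          rcases Sym2.eq_iff.1 h with ⟨rfl, rfl⟩ | ⟨rfl, rfl⟩ <;> simp at hne
        obtain ⟨h1, h2⟩ := hac.eq_of_leaves_side hab'.symm hx hy (hval x y hxy hs')
        exact hinj x y a b hxy hab hne h1 h2

end SimpleGraph

/-- The vertex set, after splitting `q`, of the path on the vertex set `P`. -/
def splitPath {W : Type*} (q i j : W) (P : Set W) : Set (Option W) :=
  {z | z.elim (q ∈ P ∧ (i ∈ P ∨ j ∈ P)) (· ∈ P)}

@[simp] theorem some_mem_splitPath {W : Type*} {q i j w : W} {P : Set W} :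
    some w ∈ splitPath q i j P ↔ w ∈ P := Iff.rfl

@[simp] theorem none_mem_splitPath {W : Type*} {q i j : W} {P : Set W} :
    none ∈ splitPath q i j P ↔ q ∈ P ∧ (i ∈ P ∨ j ∈ P) := Iff.rfl

namespace PathModel

open SimpleGraph

variable {V W : Type*} {G : SimpleGraph V} {T : SimpleGraph W} {P : V → Set W}

/-- A path through `q` uses at most one of `i` and `j`, so its detour through the new vertex does
not branch. Only paths containing `q` receive the new vertex, so no new intersections arise. -/
theorem splitVertex (hM : PathModel G T P) {q i j : W} (hij : i ≠ j) (hi : T.Adj q i)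
    (hj : T.Adj q j) (hno : ∀ v, ¬ (q ∈ P v ∧ i ∈ P v ∧ j ∈ P v)) :
    PathModel G (T.splitVertex q i j) (fun v => splitPath q i j (P v)) := by
  refine ⟨hM.isTree.splitVertex hi hj, fun v => ?_, ?_, ?_⟩
  · have hnone : ∀ k, (k = i ∨ k = j) → (hq : q ∈ P v) → (hk : k ∈ P v) →
        ((T.splitVertex q i j).induce (splitPath q i j (P v))).Reachable
          ⟨some q, hq⟩ ⟨some k, hk⟩ := by
      intro k hk hq hkP
      have h0 : none ∈ splitPath q i j (P v) := by
        rw [none_mem_splitPath]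
        rcases hk with rfl | rfl
        · exact ⟨hq, Or.inl hkP⟩
        · exact ⟨hq, Or.inr hkP⟩
      have h1 : ((T.splitVertex q i j).induce (splitPath q i j (P v))).Adj ⟨some q, hq⟩
          ⟨none, h0⟩ := Or.inl rfl
      have h2 : ((T.splitVertex q i j).induce (splitPath q i j (P v))).Adj ⟨none, h0⟩
          ⟨some k, hkP⟩ := Or.inr hk
      exact h1.reachable.trans h2.reachable
    have : Nonempty (splitPath q i j (P v)) := by
      obtain ⟨z, hz⟩ := hM.nonempty v
      exact ⟨⟨some z, hz⟩⟩
    refine ⟨(hM.connected v).preconnected.of_map (fun z => ⟨some z, z.2⟩) ?_ ?_⟩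
    · rintro ⟨a, ha⟩ ⟨b, hb⟩ hab
      by_cases h1 : s(a, b) = s(q, i)
      · rcases Sym2.eq_iff.1 h1 with ⟨rfl, rfl⟩ | ⟨rfl, rfl⟩
        · exact hnone _ (Or.inl rfl) _ _
        · exact (hnone _ (Or.inl rfl) _ _).symm
      by_cases h2 : s(a, b) = s(q, j)
      · rcases Sym2.eq_iff.1 h2 with ⟨rfl, rfl⟩ | ⟨rfl, rfl⟩
        · exact hnone _ (Or.inr rfl) _ _
        · exact (hnone _ (Or.inr rfl) _ _).symm
      exact Adj.reachable ⟨hab, h1, h2⟩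
    · rintro ⟨_ | y, hy⟩
      · exact ⟨⟨q, hy.1⟩, Adj.reachable (Or.inl rfl)⟩
      · exact ⟨⟨y, hy⟩, Reachable.refl _⟩
  · rintro v (_ | x) hx a ha b hb c hc hxa hxb hxc
    · have := hno v
      rcases a with _ | a <;> rcases b with _ | b <;> rcases c with _ | c <;>
        simp only [splitVertex_adj_none_some, splitVertex_adj_none_none, some_mem_splitPath] at *
      all_goals grind
    · obtain ⟨t, ht⟩ : ∃ t, none ∈ splitPath q i j (P v) → t ∈ P v ∧ (t = i ∨ t = j) := by
        by_cases h0 : none ∈ splitPath q i j (P v)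
        · rcases h0.2 with h | h
          · exact ⟨i, fun _ => ⟨h, Or.inl rfl⟩⟩
          · exact ⟨j, fun _ => ⟨h, Or.inr rfl⟩⟩
        · exact ⟨q, fun h => absurd h h0⟩
      by_cases hxq : x = q
      · subst hxq
        have h1 : ∀ a ∈ splitPath x i j (P v), (T.splitVertex x i j).Adj (some x) a →
            a.getD t ∈ P v ∧ T.Adj x (a.getD t) ∧ (a = none ∨ ∃ w, a = some w ∧ w ≠ i ∧ w ≠ j) := by
          rintro (_ | a) ha hxa
          · obtain ⟨h, rfl | rfl⟩ := ht ha
            · exact ⟨h, hi, Or.inl rfl⟩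
            · exact ⟨h, hj, Or.inl rfl⟩
          · obtain ⟨h1, h2, h3⟩ := splitVertex_adj_self hxa
            exact ⟨ha, h1, Or.inr ⟨a, rfl, h2, h3⟩⟩
        obtain ⟨a1, a2, a3⟩ := h1 a ha hxa
        obtain ⟨b1, b2, b3⟩ := h1 b hb hxb
        obtain ⟨c1, c2, c3⟩ := h1 c hc hxc
        have := hM.two_nbrs v x hx _ a1 _ b1 _ c1 a2 b2 c2
        rcases a3 with rfl | ⟨a, rfl, -⟩ <;> rcases b3 with rfl | ⟨b, rfl, -⟩ <;>
          rcases c3 with rfl | ⟨c, rfl, -⟩ <;>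
          simp only [Option.getD_none, Option.getD_some] at * <;> grind
      · have h1 : ∀ a ∈ splitPath q i j (P v), a.getD q ∈ P v := by
          rintro (_ | a) ha
          · exact ha.1
          · exact ha
        have h2 := hM.two_nbrs v x hx _ (h1 a ha) _ (h1 b hb) _ (h1 c hc)
          (splitVertex_adj_getD hi hj hxq hxa) (splitVertex_adj_getD hi hj hxq hxb)
          (splitVertex_adj_getD hi hj hxq hxc)
        exact h2.imp (splitVertex_getD_inj hxq hxa hxb)
          (Or.imp (splitVertex_getD_inj hxq hxa hxc) (splitVertex_getD_inj hxq hxb hxc))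
  · intro u v huv
    rw [hM.adj_iff u v huv]
    constructor
    · rintro ⟨z, hz, hz'⟩
      exact ⟨some z, hz, hz'⟩
    · rintro ⟨_ | z, hz, hz'⟩
      · exact ⟨q, hz.1, hz'.1⟩
      · exact ⟨z, hz, hz'⟩

end PathModel

/-! ### Degrees and colourings after a split -/

namespace SimpleGraph

variable {W : Type*} [Finite W] {T : SimpleGraph W} {q i j : W}

theorem ncard_neighborSet_splitVertex_none :
    ((T.splitVertex q i j).neighborSet none).ncard ≤ 3 := by
  have hsub : (T.splitVertex q i j).neighborSet none ⊆ {some q, some i, some j} := by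
    rintro (_ | b) hb
    · exact absurd hb (by simp)
    · simpa using hb
  refine (Set.ncard_le_ncard hsub).trans ((Set.ncard_insert_le _ _).trans ?_)
  have := Set.ncard_insert_le (some i) {some j}
  rw [Set.ncard_singleton] at this
  omega

theorem ncard_neighborSet_splitVertex_some (hi : T.Adj q i) (hj : T.Adj q j) {x : W}
    (hx : x ≠ q) :
    ((T.splitVertex q i j).neighborSet (some x)).ncard ≤ (T.neighborSet x).ncard :=
  Set.ncard_le_ncard_of_injOn (fun a => a.getD q)
    (fun _ ha => splitVertex_adj_getD hi hj hx ha)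
    (fun _ ha _ hb hab => splitVertex_getD_inj hx ha hb hab)

theorem ncard_neighborSet_splitVertex_self (hij : i ≠ j) (hi : T.Adj q i) (hj : T.Adj q j) :
    ((T.splitVertex q i j).neighborSet (some q)).ncard < (T.neighborSet q).ncard := by
  -- The new vertex takes the place of `i` among the neighbours of `q`, and `j` is lost.
  refine lt_of_le_of_lt (Set.ncard_le_ncard_of_injOn (t := T.neighborSet q \ {j})
    (fun a => a.getD i) ?_ ?_) (Set.ncard_sdiff_singleton_lt_of_mem hj)
  · rintro (_ | a) ha
    · exact ⟨hi, hij⟩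
    · obtain ⟨h1, -, h3⟩ := splitVertex_adj_self ha
      exact ⟨h1, h3⟩
  · rintro (_ | a) ha (_ | b) hb hab
    · rfl
    · exact absurd hab.symm (splitVertex_adj_self hb).2.1
    · exact absurd hab (splitVertex_adj_self ha).2.1
    · exact congrArg some hab

end SimpleGraph

/-- `f` colours the neighbours of `q` so that no path of the family `P` runs through `q` between two
neighbours of the same colour. -/
def IsNbrColoring {V W : Type*} {h : ℕ} (T : SimpleGraph W) (P : V → Set W) (q : W)
    (f : W → Fin h) : Prop :=
  ∀ i j, i ≠ j → T.Adj q i → T.Adj q j → (∃ v, q ∈ P v ∧ i ∈ P v ∧ j ∈ P v) → f i ≠ f j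

-- The three neighbours of the new vertex get distinct colours, which needs `h ≥ 3`. At `q` the new
-- vertex inherits the common colour of `i` and `j`; elsewhere the old colours are read through
-- `getD q`.
open SimpleGraph in
theorem exists_isNbrColoring_splitVertex {V W : Type*} {T : SimpleGraph W} {P : V → Set W} {h : ℕ}
    (hh : 3 ≤ h) {f : W → W → Fin h} (hf : ∀ q, IsNbrColoring T P q (f q)) {q i j : W}
    (hij : i ≠ j) (hi : T.Adj q i) (hj : T.Adj q j) (hfij : f q i = f q j) (z : Option W) :
    ∃ g, IsNbrColoring (h := h) (T.splitVertex q i j) (fun v => splitPath q i j (P v)) z g := by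
  classical
  rcases z with _ | x
  · refine ⟨fun a => if a = some q then ⟨0, by omega⟩ else if a = some i then ⟨1, by omega⟩
      else ⟨2, by omega⟩, ?_⟩
    rintro (_ | a) (_ | b) hab ha hb -
    · exact absurd rfl hab
    · exact absurd ha (by simp)
    · exact absurd hb (by simp)
    · have hqi := hi.ne
      have hqj := hj.ne
      rcases ha with rfl | rfl | rfl <;> rcases hb with rfl | rfl | rfl <;>
        simp_all [Ne.symm]
  · by_cases hxq : x = q
    · subst hxq
      refine ⟨fun a => f x (a.getD i), ?_⟩
      have key : ∀ a v, (T.splitVertex x i j).Adj (some x) (some a) → x ∈ P v → a ∈ P v →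
          (i ∈ P v ∨ j ∈ P v) → f x i ≠ f x a := by
        intro a v ha hxv hav hv
        obtain ⟨h1, h2, h3⟩ := splitVertex_adj_self ha
        rcases hv with hv | hv
        · exact hf x i a h2.symm hi h1 ⟨v, hxv, hv, hav⟩
        · rw [hfij]
          exact hf x j a h3.symm hj h1 ⟨v, hxv, hv, hav⟩
      rintro (_ | a) (_ | b) hab ha hb ⟨v, hxv, hav, hbv⟩
      · exact absurd rfl hab
      · exact key b v hb hxv hbv hav.2
      · exact (key a v ha hxv hav hbv.2).symm
      · exact hf x a b (fun h => hab (congrArg some h)) ha.1 hb.1 ⟨v, hxv, hav, hbv⟩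
    · refine ⟨fun a => f x (a.getD q), ?_⟩
      rintro a b hab ha hb ⟨v, hxv, hav, hbv⟩
      have h1 : ∀ a ∈ splitPath q i j (P v), a.getD q ∈ P v := by
        rintro (_ | a) ha
        · exact ha.1
        · exact ha
      exact hf x _ _ (fun h => hab (splitVertex_getD_inj hxq ha hb h))
        (splitVertex_adj_getD hi hj hxq ha) (splitVertex_adj_getD hi hj hxq hb)
        ⟨v, hxv, h1 a hav, h1 b hbv⟩

/-- Splitting vertices brings the maximum degree down to the number of colours. -/
theorem PathModel.exists_bounded_degree {V : Type*} {G : SimpleGraph V} {h : ℕ} (hh : 3 ≤ h)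
    {W : Type} [Finite W] {T : SimpleGraph W} {P : V → Set W} (hM : PathModel G T P)
    (hcol : ∀ q, ∃ f : W → Fin h, IsNbrColoring T P q f) : HasRepresentation h 2 1 G := by
  have := Fintype.ofFinite W
  -- The measure is the total excess of the degrees over `h`. By truncated subtraction the new
  -- vertex, of degree at most three, contributes nothing, while the term of `q` drops strictly.
  induction hn : ∑ w : W, ((T.neighborSet w).ncard - h) using Nat.strong_induction_on
    generalizing W with
  | _ n ih =>
    by_cases hdeg : ∀ w, (T.neighborSet w).ncard ≤ h
    · refine hasRepresentation_two_one_iff.2 ⟨W, inferInstance, T, P, hM, fun w => ?_⟩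
      rw [← (Set.toFinite (T.neighborSet w)).cast_ncard_eq]
      exact_mod_cast hdeg w
    · push Not at hdeg
      obtain ⟨q, hq⟩ := hdeg
      choose f hf using hcol
      obtain ⟨i, hi, j, hj, hij, hfij⟩ := Set.exists_ne_map_eq_of_ncard_lt_of_maps_to
        (s := T.neighborSet q) (t := (Set.univ : Set (Fin h))) (f := f q)
        (by rwa [Set.ncard_univ, Nat.card_fin]) (fun _ _ => Set.mem_univ _)
      have hno : ∀ v, ¬ (q ∈ P v ∧ i ∈ P v ∧ j ∈ P v) := fun v hv =>
        hf q i j hij hi hj ⟨v, hv⟩ hfij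
      refine ih _ ?_ (hM.splitVertex hij hi hj hno)
        (exists_isNbrColoring_splitVertex hh hf hij hi hj hfij) inferInstance rfl
      rw [← hn, Fintype.sum_option,
        Nat.sub_eq_zero_of_le (SimpleGraph.ncard_neighborSet_splitVertex_none.trans hh), zero_add]
      have hself := SimpleGraph.ncard_neighborSet_splitVertex_self hij hi hj
      refine Finset.sum_lt_sum (fun x _ => ?_) ⟨q, Finset.mem_univ _, by omega⟩
      by_cases hx : x = q
      · subst hx
        omega
      · exact Nat.sub_le_sub_right
          (SimpleGraph.ncard_neighborSet_splitVertex_some hi hj hx) _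

theorem theorem3p4 {V : Type*} [Finite V] (G : SimpleGraph V) (hG : IsVPT G) :
    (∀ h : ℕ, 3 ≤ h →
      (HasRepresentation (h : ℕ∞) 2 1 G ↔
        ∀ C : Set V, IsMaxClique G C → (branchGraph G C).Colorable h)) ∧
    (HasRepresentation 2 2 1 G →
      ∀ C : Set V, IsMaxClique G C → (branchGraph G C).Colorable 2) := by
  have forward : ∀ h : ℕ, HasRepresentation (h : ℕ∞) 2 1 G →
      ∀ C : Set V, IsMaxClique G C → (branchGraph G C).Colorable h := by
    intro h hrep C hC
    obtain ⟨W, _, T, P, hM, hdeg⟩ := hasRepresentation_two_one_iff.1 hrep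
    exact hM.branchGraph_colorable hdeg hC
  refine ⟨fun h hh => ⟨forward h, fun hcol => ?_⟩, fun hrep => forward 2 hrep⟩
  obtain ⟨W, _, T, P, hM, -⟩ := hasRepresentation_two_one_iff.1 hG
  obtain ⟨W', _, T', P', hM', hirr⟩ := hM.exists_irredundant
  exact hM'.exists_bounded_degree hh (hM'.exists_nbr_coloring hirr (by omega) hcol)
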